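/- Let $X$ be a real reflexive Banach space with a topological direct sum decomposition $X=X^+\oplus X^-$, where $X^+$ is a Hilbert space whose norm is that of $X$; write $u=u^++u^-$ with $u^\pm\in X^\pm$, and let $\|u\|^2=\|u^+\|^2+\|u^-\|^2$. Write $u_n\xrightarrow{\mathcal T}u$ if $u_n^+\to u^+$ in norm and $u_n^-\rightharpoonup u^-$ weakly. Let $\mathcal I:X\to\mathbb R$, and put $$\mathcal J(u)=\tfrac12\|u^+\|^2-\mathcal I(u),\qquad \mathcal M=\{u\in X:\mathcal J'(u)|_{X^-}=0\},\qquad \mathcal N=\{u\in X\setminus X^-:\mathcal J'(u)|_{\mathbb Ru+X^-}=0\}.$$ Assume: (I1) $\mathcal I\in C^1(X,\mathbb R)$ and $\mathcal I(u)\ge\mathcal I(0)=0$ for all $u\in X$. (I2) If $u_n\xrightarrow{\mathcal T}u$, then $\liminf_n\mathcal I(u_n)\ge\mathcal I(u)$. (I3) If $u_n\xrightarrow{\mathcal T}u$ and $\mathcal I(u_n)\to\mathcal I(u)$, then $u_n\to u$ in norm. (I4) $\|u^+\|+\mathcal I(u)\to\infty$ as $\|u\|\to\infty$. (I5) If $u\in\mathcal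 M$, then $\mathcal I(u)<\mathcal I(u+v)$ for every $v\in X^-\setminus\{0\}$. (I6) $r>0$ is such that $a:=\inf\{\mathcal J(u):u\in X^+,\ \|u\|=r\}>0$. (I7) $\mathcal Q\subset X^+$ is an infinite-dimensional closed vector subspace such that $\mathcal I(m(t_nu_n))/t_n^2\to\infty$ whenever $t_n\to\infty$, $u_n\in\mathcal Q$ and $u_n\to u\neq0$. Here $m:X^+\to\mathcal M$ maps $x\in X^+$ to the unique $u\in\mathcal M$ with $u^+=x$. (I8) $\frac{t^2-1}{2}\mathcal I'(u)[u]+t\,\mathcal I'(u)[v]+\mathcal I(u)-\mathcal I(tu+v)\le0$ for all $u\in\mathcal N$, $t\ge0$, $v\in X^-$. Let $\Gamma$ be the set of continuous $\gamma:[0,1]\to\mathcal M$ with $\gamma(0)=0$, $\|\gamma(1)^+\|>r$ and $\mathcal J(\gamma(1))<0$, and let $$c_{\mathcal M}=\inf_{\gamma\in\Gamma}\sup_{t\in[0,1]}\mathcal J(\gamma(t)).$$ Then $m$ is well defined, that is, for each $x\in X^+$ there is exactly one $u\in\mathcal M$ with $u^+=x$, and $\widetilde{\mathcal J}:=\mathcal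 J\circ m$ belongs to $C^1(X^+,\mathbb R)$. The level $c_{\mathcal M}$ is finite and $\widetilde{\mathcal J}$ has a Cerami sequence at this level: there are $u_n\in X^+$ with $(1+\|u_n\|)\widetilde{\mathcal J}'(u_n)\to0$ and $\widetilde{\mathcal J}(u_n)\to c_{\mathcal M}$. Moreover $$0<a\le c_{\mathcal M}\le\inf_{\gamma\in\Gamma,\ \gamma([0,1])\subset m(\mathcal Q)}\ \sup_{t\in[0,1]}\mathcal J(\gamma(t))=\inf_{\mathcal N\cap m(\mathcal Q)}\mathcal J=\inf_{u\in\mathcal Q\setminus\{0\}}\ \sup_{t\ge0}\mathcal J(m(tu)).$$ -/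

import Mathlib

open Filter Topology

noncomputable section

namespace StronglyIndefinite

/-- The Banach space `X = X⁺ ⊕ X⁻` with `‖u‖² = ‖u⁺‖² + ‖u⁻‖²`. For `u : Space Xp Xm`, the
summands are `u.fst = u⁺` and `u.snd = u⁻`. -/
abbrev Space (Xp Xm : Type*) := WithLp 2 (Xp × Xm)

/-- A real normed space is reflexive if the canonical embedding into its bidual is onto. -/
def IsReflexiveSpace (E : Type*) [NormedAddCommGroup E] [NormedSpace ℝ E] : Prop :=
  Function.Surjective (NormedSpace.inclusionInDoubleDual ℝ E)

variable {Xp Xm : Type*} [NormedAddCommGroup Xp] [InnerProductSpace ℝ Xp]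
  [NormedAddCommGroup Xm] [NormedSpace ℝ Xm]

/-- The inclusion of `X⁺` into `X`. -/
def inclPos (x : Xp) : Space Xp Xm := WithLp.toLp 2 (x, 0)

/-- The inclusion of `X⁻` into `X`. -/
def inclNeg (y : Xm) : Space Xp Xm := WithLp.toLp 2 (0, y)

/-- Sequential convergence in the topology `𝒯`, the product of the norm topology of `X⁺` and the
weak topology of `X⁻`. -/
def TTendsto (u : ℕ → Space Xp Xm) (w : Space Xp Xm) : Prop :=
  Tendsto (fun n => (u n).fst) atTop (𝓝 w.fst) ∧
    Tendsto (fun n => toWeakSpace ℝ Xm (u n).snd) atTop (𝓝 (toWeakSpace ℝ Xm w.snd))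

/-- `𝒥(u) = ½‖u⁺‖² - ℐ(u)`. -/
def energy (I : Space Xp Xm → ℝ) (u : Space Xp Xm) : ℝ := 1 / 2 * ‖u.fst‖ ^ 2 - I u

/-- `ℳ = {u ∈ X : 𝒥'(u) vanishes on X⁻}`. -/
def constraintSet (I : Space Xp Xm → ℝ) : Set (Space Xp Xm) :=
  {u | ∀ v : Xm, fderiv ℝ (energy I) u (inclNeg v) = 0}

/-- `𝒩 = {u ∈ X ∖ X⁻ : 𝒥'(u) vanishes on ℝu + X⁻}`. -/
def nehariSet (I : Space Xp Xm → ℝ) : Set (Space Xp Xm) :=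
  {u | u.fst ≠ 0 ∧ ∀ (s : ℝ) (v : Xm), fderiv ℝ (energy I) u (s • u + inclNeg v) = 0}

/-- `m : X⁺ → ℳ`, where `m(x)` is the element `u` of `ℳ` with `u⁺ = x`; existence and uniqueness
of this element are part of the theorem. -/
def lift (I : Space Xp Xm → ℝ) (x : Xp) : Space Xp Xm :=
  Classical.epsilon fun u => u ∈ constraintSet I ∧ u.fst = x

/-- The reduced functional `𝒥 ∘ m` on `X⁺`. -/
def reduced (I : Space Xp Xm → ℝ) (x : Xp) : ℝ := energy I (lift I x)

/-- The infimum of `𝒥` over the sphere of radius `r` in `X⁺`. -/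
def sphereInf (I : Space Xp Xm → ℝ) (r : ℝ) : EReal :=
  ⨅ x : Xp, ⨅ _ : ‖x‖ = r, (energy I (inclPos x) : EReal)

/-- The set `Γ` of continuous paths `γ : [0,1] → ℳ` with `γ(0) = 0`, `‖γ(1)⁺‖ > r` and
`𝒥(γ(1)) < 0`. -/
def paths (I : Space Xp Xm → ℝ) (r : ℝ) : Set C(unitInterval, Space Xp Xm) :=
  {γ | (∀ t, γ t ∈ constraintSet I) ∧ γ 0 = 0 ∧ r < ‖(γ 1).fst‖ ∧ energy I (γ 1) < 0}

/-- The minimax level of `𝒥` over a set of paths. -/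
def minimax (I : Space Xp Xm → ℝ) (P : Set C(unitInterval, Space Xp Xm)) : EReal :=
  ⨅ γ ∈ P, ⨆ t : unitInterval, (energy I (γ t) : EReal)

/-- The mountain pass level `c_ℳ`. -/
def mountainPassLevel (I : Space Xp Xm → ℝ) (r : ℝ) : EReal := minimax I (paths I r)

/-- `(u_n)` is a Cerami sequence for the `C¹` functional `Φ` at the level `c`:
`(1 + ‖u_n‖) Φ'(u_n) → 0` in the dual space and `Φ(u_n) → c`. -/
def IsCeramiSeq {E : Type*} [NormedAddCommGroup E] [NormedSpace ℝ E] (Φ : E → ℝ) (c : ℝ)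
    (u : ℕ → E) : Prop :=
  Tendsto (fun n => (1 + ‖u n‖) • fderiv ℝ Φ (u n)) atTop (𝓝 0) ∧
    Tendsto (fun n => Φ (u n)) atTop (𝓝 c)

end StronglyIndefinite

end

open StronglyIndefinite

/-! On each fibre `u⁺ = x` the direct method gives a minimizer of `I`. Every point of `ℳ` is the
strict minimizer of its fibre, so `m(x)` is that minimizer. Comparing `m(y)` with translates of
`m(x)` makes `m` continuous and, by an envelope argument (`hasFDerivAt_comp_lift`), makes `reduced
I` of class `C¹` although `m` is only continuous.

Paths in `ℳ` thus correspond to paths in the Hilbert space `X⁺`, where `reduced I` has mountain pass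
geometry. Ekeland's principle is applied to paths, with a metric in which a displacement at `x` is
weighted by about `1 / (1 + ‖x‖)`; deforming along a cut-off negative gradient then yields Cerami
sequences (`exists_almost_critical`), with no flow.

By (I8), a point of `𝒩` maximizes `energy I` on its half-space (`NehariInequality.energy_le`). Hence
the radial derivative of `reduced I` is nonnegative on a small sphere and negative wherever `reduced
I < 0`, so each path of `Γ` meets `𝒩`. Conversely (I7) makes `reduced I` negative far out on rays in
`Q`, which gives such rays a point of `𝒩` and turns them into admissible paths. The three levels
over `Q` then coincide. -/

/-! ### Weak sequential compactness in reflexive spaces. -/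

theorem isReflexiveSpace_snd {Xp Xm : Type*} [NormedAddCommGroup Xp] [InnerProductSpace ℝ Xp]
    [NormedAddCommGroup Xm] [NormedSpace ℝ Xm]
    (hX : IsReflexiveSpace (Space Xp Xm)) : IsReflexiveSpace Xm := by
  intro φ
  let i : Xm →L[ℝ] Space Xp Xm :=
    (WithLp.prodContinuousLinearEquiv 2 ℝ Xp Xm).symm.toContinuousLinearMap.comp
      (ContinuousLinearMap.inr ℝ Xp Xm)
  let restrict : StrongDual ℝ (Space Xp Xm) →L[ℝ] StrongDual ℝ Xm :=
    (ContinuousLinearMap.compL ℝ Xm (Space Xp Xm) ℝ).flip i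
  obtain ⟨u, hu⟩ := hX (φ.comp restrict)
  refine ⟨u.snd, ?_⟩
  ext g
  have h := DFunLike.congr_fun hu (g.comp (WithLp.sndL 2 ℝ Xp Xm))
  have hg : restrict (g.comp (WithLp.sndL 2 ℝ Xp Xm)) = g := by
    ext y
    rfl
  simp only [ContinuousLinearMap.comp_apply, hg] at h
  rw [← h]
  rfl

/-- Norming functionals of a dense sequence suffice: one that kills `y` has norming point `d n` with
`‖d n‖ ≤ ‖y - d n‖`, impossible when `d n` is closer to `y` than `‖y‖ / 2`. -/
theorem exists_countable_dual_separating {E : Type*} [NormedAddCommGroup E] [NormedSpace ℝ E]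
    {s : Set E} (hs : TopologicalSpace.IsSeparable s) :
    ∃ g : ℕ → StrongDual ℝ E, ∀ y ∈ s, y ≠ 0 → ∃ n, g n y ≠ 0 := by
  obtain ⟨c, hc, hsc⟩ := hs
  rcases s.eq_empty_or_nonempty with rfl | hne
  · exact ⟨0, by simp⟩
  have hcne : c.Nonempty := by
    by_contra h
    rw [Set.not_nonempty_iff_eq_empty] at h
    simp only [h, closure_empty] at hsc
    exact hne.ne_empty (Set.subset_empty_iff.1 hsc)
  obtain ⟨d, rfl⟩ := hc.exists_eq_range hcne
  choose g hg1 hg2 using fun n => exists_dual_vector'' ℝ (d n)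
  refine ⟨g, fun y hy hy0 => ?_⟩
  have hpos : 0 < ‖y‖ := norm_pos_iff.2 hy0
  obtain ⟨_, ⟨n, rfl⟩, hn⟩ := Metric.mem_closure_iff.1 (hsc hy) (‖y‖ / 2) (by positivity)
  refine ⟨n, fun h0 => ?_⟩
  have h1 : ‖d n‖ ≤ ‖y - d n‖ := by
    have h2 : g n (d n - y) = ‖d n‖ := by rw [map_sub, h0, hg2]; simp
    calc ‖d n‖ = ‖g n (d n - y)‖ := by rw [h2]; simp
      _ ≤ ‖g n‖ * ‖d n - y‖ := (g n).le_opNorm _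
      _ ≤ 1 * ‖d n - y‖ := by gcongr; exact hg1 n
      _ = ‖y - d n‖ := by rw [one_mul, norm_sub_rev]
  rw [dist_eq_norm] at hn
  have h3 : ‖y‖ ≤ ‖d n‖ + ‖y - d n‖ := by
    calc ‖y‖ = ‖d n + (y - d n)‖ := by congr 1; abel
      _ ≤ _ := norm_add_le _ _
  linarith

/-- The weak closure of the range is weakly compact by reflexivity. It lies in a separable subspace,
where countably many functionals separate points, so it is metrizable and compactness becomes
sequential. -/
theorem exists_weakly_convergent_subseq {E : Type*} [NormedAddCommGroup E] [NormedSpace ℝ E]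
    (hE : IsReflexiveSpace E) {v : ℕ → E} {R : ℝ} (hv : ∀ n, ‖v n‖ ≤ R) :
    ∃ (w : E) (k : ℕ → ℕ), StrictMono k ∧
      Tendsto (fun n => toWeakSpace ℝ E (v (k n))) atTop (𝓝 (toWeakSpace ℝ E w)) := by
  let S : Set (WeakSpace ℝ E) := toWeakSpace ℝ E '' Set.range v
  let Y : Submodule ℝ E := (Submodule.span ℝ (Set.range v)).topologicalClosure
  have hK : IsCompact (closure S) := by
    apply NormedSpace.isCompact_closure_of_isBounded
    · rw [Set.preimage_image_eq _ (toWeakSpace ℝ E).injective]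
      refine isBounded_iff_forall_norm_le.2 ⟨R, ?_⟩
      rintro _ ⟨n, rfl⟩
      exact hv n
    · intro φ _
      obtain ⟨x, hx⟩ := hE (WeakDual.toStrongDual φ)
      refine ⟨toWeakSpace ℝ E x, ?_⟩
      exact DFunLike.ext _ _ fun g => DFunLike.congr_fun hx g
  -- Mazur: the norm closure of a convex set is its weak closure.
  have hSY : closure S ⊆ toWeakSpace ℝ E '' (Y : Set E) := by
    have h := (Submodule.span ℝ (Set.range v)).convex.toWeakSpace_closure (𝕜 := ℝ)
    change closure S ⊆ toWeakSpace ℝ E '' (closure (Submodule.span ℝ (Set.range v) : Set E))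
    rw [h]
    exact closure_mono (Set.image_mono Submodule.subset_span)
  have hsep : TopologicalSpace.IsSeparable (Y : Set E) := by
    have h1 : TopologicalSpace.IsSeparable (Set.range v) := (Set.countable_range v).isSeparable
    exact (h1.span (R := ℝ)).closure
  obtain ⟨g, hg⟩ := exists_countable_dual_separating hsep
  have : CompactSpace (closure S) := isCompact_iff_compactSpace.1 hK
  have hmetr : TopologicalSpace.MetrizableSpace (closure S) := by
    refine Metric.PiNatEmbed.TopologicalSpace.MetrizableSpace.of_countable_separating
      (fun n (x : closure S) => g n ((toWeakSpace ℝ E).symm x.1)) (fun n => ?_) ?_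
    · exact (WeakBilin.eval_continuous (topDualPairing ℝ E).flip (g n)).comp
        continuous_subtype_val
    · intro x y hxy
      obtain ⟨x', hx', hx⟩ := hSY x.2
      obtain ⟨y', hy', hy⟩ := hSY y.2
      have hne : x' - y' ≠ 0 := by
        intro h
        apply hxy
        apply Subtype.ext
        rw [← hx, ← hy, sub_eq_zero.1 h]
      obtain ⟨n, hn⟩ := hg _ (Y.sub_mem hx' hy') hne
      refine ⟨n, ?_⟩
      rw [← hx, ← hy]
      rw [map_sub] at hn
      simpa [sub_ne_zero] using hn
  let V : ℕ → closure S := fun n =>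
    ⟨toWeakSpace ℝ E (v n), subset_closure ⟨v n, ⟨n, rfl⟩, rfl⟩⟩
  obtain ⟨w, k, hk, hw⟩ := CompactSpace.tendsto_subseq V
  refine ⟨(toWeakSpace ℝ E).symm w.1, k, hk, ?_⟩
  rw [LinearEquiv.apply_symm_apply]
  exact (continuous_subtype_val.tendsto w).comp hw

/-! ### Almost minimizers in complete metric spaces. -/

/-- **Ekeland's variational principle**. -/
theorem LowerSemicontinuous.exists_ekeland {Z : Type*} [MetricSpace Z] [CompleteSpace Z]
    {f : Z → ℝ} (hf : LowerSemicontinuous f) {b : ℝ} (hb : ∀ x, b ≤ f x) {ε : ℝ} (hε : 0 < ε)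
    (x₀ : Z) :
    ∃ x, f x + ε * dist x₀ x ≤ f x₀ ∧ ∀ y, f x ≤ f y + ε * dist x y := by
  -- `y ∈ S x` is a partial order; the limit of a sequence of nearly minimal choices is a minimal
  -- element.
  let S : Z → Set Z := fun x => {y | f y + ε * dist x y ≤ f x}
  have hself : ∀ x, x ∈ S x := fun x => by simp [S]
  have htrans : ∀ x, ∀ y ∈ S x, ∀ z ∈ S y, z ∈ S x := by
    intro x y hy z hz
    simp only [S, Set.mem_ofPred_eq] at *
    nlinarith [dist_triangle x y z]
  have hstep : ∀ (n : ℕ) (x : Z), ∃ y ∈ S x, ∀ z ∈ S x, f y ≤ f z + (1 / 2) ^ n := by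
    intro n x
    have hbdd : BddBelow (f '' S x) := ⟨b, by rintro _ ⟨z, -, rfl⟩; exact hb z⟩
    have hne : (f '' S x).Nonempty := ⟨f x, x, hself x, rfl⟩
    obtain ⟨_, ⟨y, hy, rfl⟩, hlt⟩ := exists_lt_of_csInf_lt hne
      (lt_add_of_pos_right (sInf (f '' S x)) (pow_pos (by norm_num : (0 : ℝ) < 1 / 2) n))
    exact ⟨y, hy, fun z hz => by linarith [csInf_le hbdd ⟨z, hz, rfl⟩]⟩
  choose next hnext hmin using hstep
  let x : ℕ → Z := fun n => Nat.rec x₀ next n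
  have hx : ∀ n, x (n + 1) = next n (x n) := fun n => rfl
  have hmem : ∀ n m, n ≤ m → x m ∈ S (x n) := by
    intro n m hnm
    induction m, hnm using Nat.le_induction with
    | base => exact hself _
    | succ m _ ih => exact htrans _ _ ih _ (hx m ▸ hnext m (x m))
  have hdist : ∀ n m, n ≤ m → f (x m) + ε * dist (x n) (x m) ≤ f (x n) := hmem
  have hanti : Antitone fun n => f (x n) := fun n m hnm => by
    have := hdist n m hnm
    have := mul_nonneg hε.le (dist_nonneg (x := x n) (y := x m))
    simp only
    linarith
  have hbdd : BddBelow (Set.range fun n => f (x n)) := ⟨b, by rintro _ ⟨n, rfl⟩; exact hb _⟩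
  have hlim := tendsto_atTop_ciInf hanti hbdd
  set L := ⨅ n, f (x n)
  have hL : ∀ n, L ≤ f (x n) := fun n => ciInf_le hbdd n
  have hcauchy : CauchySeq x := by
    refine cauchySeq_of_le_tendsto_0 (fun n => (f (x n) - L) / ε * 2) ?_ ?_
    · intro n m N hn hm
      have h1 := hdist N n hn
      have h2 := hdist N m hm
      have h3 := dist_triangle_left (x n) (x m) (x N)
      have h4 : dist (x N) (x n) ≤ (f (x N) - L) / ε := by
        rw [le_div_iff₀ hε]; linarith [hL n]
      have h5 : dist (x N) (x m) ≤ (f (x N) - L) / ε := by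
        rw [le_div_iff₀ hε]; linarith [hL m]
      linarith
    · have := ((hlim.sub_const L).div_const ε).mul_const 2
      simpa using this
  obtain ⟨z, hz⟩ := cauchySeq_tendsto_of_complete hcauchy
  have hfz : f z ≤ L := by
    by_contra! h
    obtain ⟨q, hq1, hq2⟩ := exists_between h
    obtain ⟨n, hn1, hn2⟩ := ((hz.eventually (hf z q hq2)).and (hlim.eventually_lt_const hq1)).exists
    exact absurd hn1 (not_lt.2 hn2.le)
  have hzS : ∀ n, z ∈ S (x n) := by
    intro n
    have h1 : Tendsto (fun m => f (x m) + ε * dist (x n) (x m)) atTop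
        (𝓝 (L + ε * dist (x n) z)) := hlim.add ((tendsto_const_nhds.dist hz).const_mul ε)
    have h2 := le_of_tendsto h1 (eventually_atTop.2 ⟨n, fun m hm => hdist n m hm⟩)
    simp only [S, Set.mem_ofPred_eq]
    linarith
  refine ⟨z, hzS 0, fun y => ?_⟩
  -- A point of `S z` lies in every `S (x n)`, so its value is at least `L ≥ f z`. Off `S z` the
  -- claim is the negated membership.
  by_cases hy : y ∈ S z
  · have h1 : ∀ n, f (x (n + 1)) ≤ f y + (1 / 2) ^ n := fun n =>
      hmin n (x n) y (htrans _ _ (hzS n) _ hy)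
    have h2 : L ≤ f y + 0 := le_of_tendsto_of_tendsto' (hlim.comp (tendsto_add_atTop_nat 1))
      (tendsto_const_nhds.add (tendsto_pow_atTop_nhds_zero_of_lt_one (by norm_num) (by norm_num)))
      h1
    have := mul_nonneg hε.le (dist_nonneg (x := z) (y := y))
    linarith
  · simp only [S, Set.mem_ofPred_eq, not_le] at hy
    exact hy.le

/-! ### A change of metric adapted to the Cerami condition. -/

section LogCone

variable {E : Type*} [NormedAddCommGroup E] [NormedSpace ℝ E]

/-- A closed embedding of `E` into `E × ℝ`; the metric it induces has density comparable
to `1 / (1 + ‖x‖)`. -/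
noncomputable def logCone (x : E) : E × ℝ := ((1 + ‖x‖)⁻¹ • x, Real.log (1 + ‖x‖))

/-- A continuous left inverse of `logCone`. -/
noncomputable def logConeInv (p : E × ℝ) : E := Real.exp p.2 • p.1

theorem continuous_logCone : Continuous (logCone : E → E × ℝ) := by
  have h : Continuous fun x : E => 1 + ‖x‖ := by fun_prop
  have h0 : ∀ x : E, 1 + ‖x‖ ≠ 0 := fun x => by positivity
  exact ((h.inv₀ h0).smul continuous_id).prodMk (h.log h0)

theorem continuous_logConeInv : Continuous (logConeInv : E × ℝ → E) := by
  unfold logConeInv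
  fun_prop

@[simp]
theorem logConeInv_logCone (x : E) : logConeInv (logCone x) = x := by
  have h : 0 < 1 + ‖x‖ := by positivity
  simp [logConeInv, logCone, Real.exp_log h, smul_smul, mul_inv_cancel₀ h.ne']

/-- For `s ≤ 1 / 2`, `1 + ‖y‖` is at least half of `1 + ‖x‖`, so `‖x - y‖` is at most `2 * s`
relative to either weight. The first component is a sum of two terms of relative size at most `s`;
the logarithm is controlled by `log p - log q ≤ (p - q) / q`. -/
theorem dist_logCone_le {x y : E} {s : ℝ} (hs : s ≤ 1 / 2)
    (hxy : ‖x - y‖ ≤ s * (1 + ‖x‖)) : dist (logCone x) (logCone y) ≤ 2 * s := by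
  have hx : 0 < 1 + ‖x‖ := by positivity
  have hy : 0 < 1 + ‖y‖ := by positivity
  have hxy0 : |‖x‖ - ‖y‖| ≤ ‖x - y‖ := abs_norm_sub_norm_le x y
  have hs0 : 0 ≤ s := by
    by_contra! h
    nlinarith [norm_nonneg (x - y)]
  obtain ⟨hl, hu⟩ := abs_le.1 hxy0
  have hxs : ‖x - y‖ / (1 + ‖x‖) ≤ s := by rwa [div_le_iff₀ hx]
  have hys : ‖x - y‖ / (1 + ‖y‖) ≤ 2 * s := by
    rw [div_le_iff₀ hy]
    nlinarith
  rw [Prod.dist_eq]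
  refine max_le ?_ ?_
  · have h1 : (logCone x).1 - (logCone y).1 =
        (1 + ‖x‖)⁻¹ • (x - y) + ((1 + ‖x‖)⁻¹ - (1 + ‖y‖)⁻¹) • y := by
      simp only [logCone, smul_sub, sub_smul]
      abel
    rw [dist_eq_norm, h1]
    refine (norm_add_le _ _).trans ?_
    rw [norm_smul, norm_smul, norm_inv, Real.norm_of_nonneg hx.le, inv_mul_eq_div]
    have h2 : ‖(1 + ‖x‖)⁻¹ - (1 + ‖y‖)⁻¹‖ * ‖y‖ ≤ ‖x - y‖ / (1 + ‖x‖) := by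
      have h3 : (1 + ‖x‖)⁻¹ - (1 + ‖y‖)⁻¹ = (‖y‖ - ‖x‖) / ((1 + ‖x‖) * (1 + ‖y‖)) := by
        field_simp
        ring
      rw [h3, norm_div, Real.norm_eq_abs, abs_sub_comm, Real.norm_of_nonneg (by positivity),
        div_mul_eq_mul_div, div_le_div_iff₀ (by positivity) hx]
      calc |‖x‖ - ‖y‖| * ‖y‖ * (1 + ‖x‖) ≤ ‖x - y‖ * (1 + ‖y‖) * (1 + ‖x‖) := by
            gcongr
            linarith
        _ = _ := by ring
    linarith
  · simp only [logCone]
    rw [Real.dist_eq, abs_le]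
    have key : ∀ p q : ℝ, 0 < p → 0 < q → Real.log p - Real.log q ≤ (p - q) / q := by
      intro p q hp hq
      rw [← Real.log_div hp.ne' hq.ne', sub_div, div_self hq.ne']
      exact Real.log_le_sub_one_of_pos (div_pos hp hq)
    have h1 := key _ _ hx hy
    have h2 := key _ _ hy hx
    have h3 : (1 + ‖x‖ - (1 + ‖y‖)) / (1 + ‖y‖) ≤ ‖x - y‖ / (1 + ‖y‖) := by
      gcongr; linarith
    have h4 : (1 + ‖y‖ - (1 + ‖x‖)) / (1 + ‖x‖) ≤ ‖x - y‖ / (1 + ‖x‖) := by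
      gcongr; linarith
    constructor <;> linarith

end LogCone

/-! ### Almost critical points from the minimax principle. -/

section MountainPass

variable {E : Type*} [NormedAddCommGroup E] [NormedSpace ℝ E]

/-- The paths in `E × ℝ` that lie on `range logCone` and join the images of `a` and `b`. -/
def logConePaths (a b : E) : Set C(unitInterval, E × ℝ) :=
  {Γ | Γ 0 = logCone a ∧ Γ 1 = logCone b ∧ ∀ t, logCone (logConeInv (Γ t)) = Γ t}

/-- The range of `logCone` is the fixed point set of the continuous map `logCone ∘ logConeInv`.
Closedness makes the path space complete, as Ekeland's principle requires. -/
theorem isClosed_logConePaths (a b : E) : IsClosed (logConePaths a b) := by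
  have h : ∀ t : unitInterval, Continuous fun Γ : C(unitInterval, E × ℝ) => Γ t :=
    fun t => continuous_eval_const t
  have h3 : IsClosed {Γ : C(unitInterval, E × ℝ) |
      ∀ t, logCone (logConeInv (Γ t)) = Γ t} := by
    rw [Set.ofPred_forall]
    exact isClosed_iInter fun t => isClosed_eq
      (continuous_logCone.comp (continuous_logConeInv.comp (h t))) (h t)
  exact ((isClosed_eq (h 0) continuous_const).inter
    ((isClosed_eq (h 1) continuous_const).inter h3))

/-- A path that is almost optimal for the minimax problem with fixed end points can be chosen
almost minimal with respect to the metric induced by `logCone`. -/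
theorem exists_ekeland_path [CompleteSpace E] {Φ : E → ℝ} (hΦ : Continuous Φ) {c ε : ℝ}
    (hε : 0 < ε) (γ₀ : C(unitInterval, E)) (hγ₀ : ∀ t, Φ (γ₀ t) ≤ c + ε)
    (hinf : ∀ γ : C(unitInterval, E), γ 0 = γ₀ 0 → γ 1 = γ₀ 1 → ∃ t, c ≤ Φ (γ t)) :
    ∃ γ : C(unitInterval, E), γ 0 = γ₀ 0 ∧ γ 1 = γ₀ 1 ∧ (∀ t, Φ (γ t) ≤ c + ε) ∧
      ∀ (σ : C(unitInterval, E)) (s : ℝ), 0 ≤ s → s ≤ 1 / 2 → σ 0 = γ₀ 0 → σ 1 = γ₀ 1 →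
        (∀ t, ‖γ t - σ t‖ ≤ s * (1 + ‖γ t‖)) →
        ∃ t, ∀ t', Φ (γ t') ≤ Φ (σ t) + 2 * ε * s := by
  let Z := logConePaths (γ₀ 0) (γ₀ 1)
  have : CompleteSpace Z := (isClosed_logConePaths _ _).completeSpace_coe
  let pr : C(unitInterval, E × ℝ) → C(unitInterval, E) := fun Γ =>
    ⟨fun t => logConeInv (Γ t), continuous_logConeInv.comp Γ.continuous⟩
  let emb : C(unitInterval, E) → C(unitInterval, E × ℝ) := fun γ =>
    ⟨fun t => logCone (γ t), continuous_logCone.comp γ.continuous⟩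
  have hemb : ∀ γ : C(unitInterval, E), γ 0 = γ₀ 0 → γ 1 = γ₀ 1 → emb γ ∈ Z := by
    intro γ h0 h1
    refine ⟨?_, ?_, fun t => ?_⟩
    · simp [emb, h0]
    · simp [emb, h1]
    · simp [emb]
  let F : C(unitInterval, E) → ℝ := fun γ => ⨆ t, Φ (γ t)
  have hbdd : ∀ γ : C(unitInterval, E), BddAbove (Set.range fun t => Φ (γ t)) := fun γ =>
    (isCompact_range (hΦ.comp γ.continuous)).bddAbove
  have hle : ∀ (γ : C(unitInterval, E)) t, Φ (γ t) ≤ F γ := fun γ t => le_ciSup (hbdd γ) t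
  have hpr0 : ∀ Γ ∈ Z, pr Γ 0 = γ₀ 0 := fun Γ hΓ => by simp [pr, hΓ.1]
  have hpr1 : ∀ Γ ∈ Z, pr Γ 1 = γ₀ 1 := fun Γ hΓ => by simp [pr, hΓ.2.1]
  let f : Z → ℝ := fun Γ => F (pr Γ.1)
  -- A supremum of functions continuous in the path.
  have hlsc : LowerSemicontinuous f := by
    intro Γ q hq
    obtain ⟨t, ht⟩ := exists_lt_of_lt_ciSup hq
    have hcont : Continuous fun Γ : Z => Φ (pr Γ.1 t) :=
      hΦ.comp (continuous_logConeInv.comp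
        ((continuous_eval_const t).comp continuous_subtype_val))
    filter_upwards [hcont.continuousAt.eventually_const_lt ht] with Γ' hΓ'
    exact hΓ'.trans_le (hle _ t)
  have hb : ∀ Γ : Z, c ≤ f Γ := by
    intro Γ
    obtain ⟨t, ht⟩ := hinf (pr Γ.1) (hpr0 _ Γ.2) (hpr1 _ Γ.2)
    exact ht.trans (hle _ t)
  obtain ⟨Γ, hΓ0, hΓ⟩ := hlsc.exists_ekeland hb hε ⟨emb γ₀, hemb γ₀ rfl rfl⟩
  have hpremb : ∀ γ, pr (emb γ) = γ := fun γ => by ext t; simp [pr, emb]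
  refine ⟨pr Γ.1, hpr0 _ Γ.2, hpr1 _ Γ.2, fun t => ?_, ?_⟩
  · have h1 : f ⟨emb γ₀, hemb γ₀ rfl rfl⟩ ≤ c + ε := by
      simp only [f, hpremb]
      exact ciSup_le hγ₀
    have h2 := hle (pr Γ.1) t
    have h3 : 0 ≤ ε * dist (⟨emb γ₀, hemb γ₀ rfl rfl⟩ : Z) Γ := by positivity
    have h4 : f Γ = F (pr Γ.1) := rfl
    linarith
  · intro σ s hs0 hs h0 h1 hσ
    have h2 := hΓ ⟨emb σ, hemb σ h0 h1⟩
    have h3 : dist Γ ⟨emb σ, hemb σ h0 h1⟩ ≤ 2 * s := by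
      rw [Subtype.dist_eq, ContinuousMap.dist_le (by positivity)]
      intro t
      have h4 := dist_logCone_le hs (hσ t)
      have h5 : logCone (pr Γ.1 t) = Γ.1 t := Γ.2.2.2 t
      rwa [h5] at h4
    obtain ⟨t, -, ht⟩ := isCompact_univ.exists_isMaxOn ⟨(0 : unitInterval), trivial⟩
      (hΦ.comp σ.continuous).continuousOn
    refine ⟨t, fun t' => ?_⟩
    have h6 : f ⟨emb σ, hemb σ h0 h1⟩ ≤ Φ (σ t) := by
      simp only [f, hpremb]
      exact ciSup_le fun t' => ht (Set.mem_univ t')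
    have h7 := hle (pr Γ.1) t'
    have h8 : f Γ = F (pr Γ.1) := rfl
    nlinarith [mul_le_mul_of_nonneg_left h3 hε.le]

/-- Push an Ekeland path `γ` by `s n • W` with `s n → 0`. If `W` were a strong descent direction at
all maximum points of `Φ ∘ γ`, the maximum would drop too fast. The required point is a limit of `γ`
at parameters where the pushed paths are maximal. -/
theorem exists_almost_nonneg_slope [CompleteSpace E] {Φ : E → ℝ} (hΦ : ContDiff ℝ 1 Φ) {c ε : ℝ}
    (hε : 0 < ε) (γ₀ : C(unitInterval, E)) (hγ₀ : ∀ t, Φ (γ₀ t) ≤ c + ε)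
    (hinf : ∀ γ : C(unitInterval, E), γ 0 = γ₀ 0 → γ 1 = γ₀ 1 → ∃ t, c ≤ Φ (γ t))
    {W : E → E} (hW : Continuous W) (hWle : ∀ x, ‖W x‖ ≤ 1 + ‖x‖) (hW0 : W (γ₀ 0) = 0)
    (hW1 : W (γ₀ 1) = 0) :
    ∃ x, c ≤ Φ x ∧ Φ x ≤ c + ε ∧ -(2 * ε) ≤ fderiv ℝ Φ x (W x) := by
  obtain ⟨γ, hγ0, hγ1, hγle, hγ⟩ := exists_ekeland_path hΦ.continuous hε γ₀ hγ₀ hinf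
  let s : ℕ → ℝ := fun n => 1 / ((n : ℝ) + 2)
  have hs0 : ∀ n, 0 < s n := fun n => by positivity
  have hs1 : ∀ n, s n ≤ 1 / 2 := fun n => by
    simp only [s]
    gcongr
    linarith [(Nat.cast_nonneg n : (0 : ℝ) ≤ n)]
  have hslim : Tendsto s atTop (𝓝 0) := by
    have := (tendsto_one_div_add_atTop_nhds_zero_nat (𝕜 := ℝ)).comp (tendsto_add_atTop_nat 1)
    refine this.congr fun n => ?_
    simp only [s, Function.comp, Nat.cast_add, Nat.cast_one]
    ring_nf
  let σ : ℕ → C(unitInterval, E) := fun n =>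
    ⟨fun t => γ t + s n • W (γ t), by fun_prop⟩
  have hσ : ∀ n, ∃ t, ∀ t', Φ (γ t') ≤ Φ (σ n t) + 2 * ε * s n := by
    intro n
    refine hγ (σ n) (s n) (hs0 n).le (hs1 n) ?_ ?_ ?_
    · simp [σ, hγ0, hW0]
    · simp [σ, hγ1, hW1]
    · intro t
      simp only [σ, ContinuousMap.coe_mk, sub_add_cancel_left, norm_neg, norm_smul,
        Real.norm_of_nonneg (hs0 n).le]
      exact mul_le_mul_of_nonneg_left (hWle _) (hs0 n).le
  choose t ht using hσ
  obtain ⟨t₀, k, hk, hkt⟩ := CompactSpace.tendsto_subseq t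
  have hγt : Tendsto (fun n => γ (t (k n))) atTop (𝓝 (γ t₀)) :=
    (γ.continuous.tendsto t₀).comp hkt
  have hWt : Tendsto (fun n => W (γ (t (k n)))) atTop (𝓝 (W (γ t₀))) :=
    (hW.tendsto _).comp hγt
  have hsk : Tendsto (fun n => s (k n)) atTop (𝓝 0) := hslim.comp hk.tendsto_atTop
  have hσt : Tendsto (fun n => γ (t (k n)) + s (k n) • W (γ (t (k n)))) atTop (𝓝 (γ t₀)) := by
    simpa using hγt.add (hsk.smul hWt)
  refine ⟨γ t₀, ?_, hγle t₀, ?_⟩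
  · obtain ⟨t₁, ht₁⟩ := hinf γ hγ0 hγ1
    have h1 : Tendsto (fun n => Φ (γ (t (k n)) + s (k n) • W (γ (t (k n)))) + 2 * ε * s (k n))
        atTop (𝓝 (Φ (γ t₀) + 2 * ε * 0)) :=
      ((hΦ.continuous.tendsto _).comp hσt).add (hsk.const_mul _)
    have h2 := ge_of_tendsto' h1 fun n => ht₁.trans (ht (k n) t₁)
    linarith
  · have hstrict : HasStrictFDerivAt Φ (fderiv ℝ Φ (γ t₀)) (γ t₀) :=
      hΦ.contDiffAt.hasStrictFDerivAt (by norm_num)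
    have h1 := hstrict.isLittleO.comp_tendsto (hσt.prodMk_nhds hγt)
    have h2 : (fun n => Φ (γ (t (k n)) + s (k n) • W (γ (t (k n)))) - Φ (γ (t (k n))) -
        s (k n) * fderiv ℝ Φ (γ t₀) (W (γ (t (k n))))) =o[atTop] fun n => s (k n) := by
      refine Asymptotics.IsLittleO.trans_isBigO (h1.congr_left fun n => ?_) ?_
      · simp [Function.comp]
      · have h3 : (fun n => s (k n) • W (γ (t (k n)))) =O[atTop] fun n => s (k n) • (1 : ℝ) :=
          (Asymptotics.isBigO_refl _ _).smul (hWt.isBigO_one ℝ)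
        simpa [Function.comp_def] using h3
    have h4 := h2.tendsto_div_nhds_zero
    have h5 : Tendsto (fun n => (Φ (γ (t (k n)) + s (k n) • W (γ (t (k n)))) -
        Φ (γ (t (k n)))) / s (k n)) atTop (𝓝 (fderiv ℝ Φ (γ t₀) (W (γ t₀)))) := by
      have h6 : Tendsto (fun n => fderiv ℝ Φ (γ t₀) (W (γ (t (k n))))) atTop
          (𝓝 (fderiv ℝ Φ (γ t₀) (W (γ t₀)))) :=
        ((fderiv ℝ Φ (γ t₀)).continuous.tendsto _).comp hWt
      have h7 := h4.add h6
      rw [zero_add] at h7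
      refine h7.congr fun n => ?_
      have := (hs0 (k n)).ne'
      field_simp
      ring
    refine ge_of_tendsto' h5 fun n => ?_
    rw [le_div_iff₀ (hs0 _)]
    have := ht (k n) (t (k n))
    simp only [σ, ContinuousMap.coe_mk] at this
    linarith

end MountainPass

/-- Test the slope bound with a rescaled negative gradient. If the weighted gradient norm `b x`
exceeded `3 * ε` at the point found, the slope there would be `-b x < -(2 * ε)`. -/
theorem exists_almost_critical {E : Type*} [NormedAddCommGroup E] [InnerProductSpace ℝ E]
    [CompleteSpace E] {Φ : E → ℝ} (hΦ : ContDiff ℝ 1 Φ) {c ε : ℝ} (hε : 0 < ε)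
    (γ₀ : C(unitInterval, E)) (hγ₀ : ∀ t, Φ (γ₀ t) ≤ c + ε)
    (h0 : Φ (γ₀ 0) < c) (h1 : Φ (γ₀ 1) < c)
    (hinf : ∀ γ : C(unitInterval, E), γ 0 = γ₀ 0 → γ 1 = γ₀ 1 → ∃ t, c ≤ Φ (γ t)) :
    ∃ x, c ≤ Φ x ∧ Φ x ≤ c + ε ∧ (1 + ‖x‖) * ‖fderiv ℝ Φ x‖ ≤ 3 * ε := by
  let c₀ := max (Φ (γ₀ 0)) (Φ (γ₀ 1))
  have hc₀ : c₀ < c := max_lt h0 h1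
  -- This cutoff fixes the end points of the path and equals `1` at levels `≥ c`.
  let χ : E → ℝ := fun x => max 0 (min 1 ((Φ x - c₀) / (c - c₀)))
  have hχ : Continuous χ := by
    have := hΦ.continuous
    fun_prop
  have hχ0 : ∀ x, 0 ≤ χ x := fun x => le_max_left _ _
  have hχ1 : ∀ x, χ x ≤ 1 := fun x => max_le zero_le_one (min_le_left _ _)
  have hχ_zero : ∀ x, Φ x ≤ c₀ → χ x = 0 := fun x hx => by
    refine max_eq_left ((min_le_right _ _).trans ?_)
    exact div_nonpos_of_nonpos_of_nonneg (by linarith) (by linarith)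
  have hχ_one : ∀ x, c ≤ Φ x → χ x = 1 := fun x hx => by
    have : 1 ≤ (Φ x - c₀) / (c - c₀) := by
      rw [one_le_div (by linarith)]
      linarith
    simp [χ, this]
  let g : E → E := fun x => (InnerProductSpace.toDual ℝ E).symm (fderiv ℝ Φ x)
  have hg : Continuous g :=
    (InnerProductSpace.toDual ℝ E).symm.continuous.comp (hΦ.continuous_fderiv (by norm_num))
  have hgn : ∀ x, ‖g x‖ = ‖fderiv ℝ Φ x‖ := fun x => by simp [g]
  have hgg : ∀ x, fderiv ℝ Φ x (g x) = ‖g x‖ ^ 2 := fun x => by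
    rw [← real_inner_self_eq_norm_sq]
    simp [g, ← InnerProductSpace.toDual_symm_apply]
  let b : E → ℝ := fun x => (1 + ‖x‖) * ‖g x‖
  -- Truncation from below keeps `W` continuous at critical points without changing it where `b x >
  -- 3 * ε`.
  let d : E → ℝ := fun x => max (b x) (3 * ε)
  have hd : ∀ x, 0 < d x := fun x => lt_max_of_lt_right (by positivity)
  let W : E → E := fun x => -((χ x * (1 + ‖x‖) ^ 2 / d x) • g x)
  have hW : Continuous W := by
    have hdc : Continuous d := by fun_prop
    refine Continuous.neg (Continuous.smul (Continuous.div ?_ hdc fun x => (hd x).ne') hg)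
    fun_prop
  have hWle : ∀ x, ‖W x‖ ≤ 1 + ‖x‖ := fun x => by
    have hpos : 0 ≤ χ x * (1 + ‖x‖) ^ 2 / d x := by
      have := hχ0 x
      have := hd x
      positivity
    simp only [W, norm_neg, norm_smul, Real.norm_of_nonneg hpos]
    rw [div_mul_eq_mul_div, div_le_iff₀ (hd x)]
    calc χ x * (1 + ‖x‖) ^ 2 * ‖g x‖ ≤ 1 * (1 + ‖x‖) ^ 2 * ‖g x‖ := by gcongr; exact hχ1 x
      _ = (1 + ‖x‖) * b x := by simp only [b]; ring
      _ ≤ (1 + ‖x‖) * d x := by gcongr; exact le_max_left _ _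
  obtain ⟨x, hx1, hx2, hx3⟩ := exists_almost_nonneg_slope hΦ hε γ₀ hγ₀ hinf hW hWle
    (by simp [W, hχ_zero _ (le_max_left _ _)]) (by simp [W, hχ_zero _ (le_max_right _ _)])
  refine ⟨x, hx1, hx2, ?_⟩
  rw [← hgn]
  by_contra! hb
  have hdx : d x = b x := max_eq_left hb.le
  have hbx : 3 * ε < b x := hb
  have hval : fderiv ℝ Φ x (W x) = -b x := by
    simp only [W, map_neg, map_smul, smul_eq_mul, hχ_one x hx1, hdx, hgg]
    have : b x ≠ 0 := by linarith
    rw [neg_inj, div_mul_eq_mul_div, div_eq_iff this]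
    simp only [b]
    ring
  linarith

/-! ### Reduction of the functional to `X⁺`. -/

section Reduction

variable {Xp Xm : Type*}

@[simp] theorem inclNeg_fst [NormedAddCommGroup Xp] (y : Xm) :
    (inclNeg y : Space Xp Xm).fst = 0 := rfl

@[simp] theorem inclNeg_snd [NormedAddCommGroup Xp] (y : Xm) :
    (inclNeg y : Space Xp Xm).snd = y := rfl

theorem space_ext {u w : Space Xp Xm} (h1 : u.fst = w.fst) (h2 : u.snd = w.snd) : u = w :=
  (WithLp.equiv 2 (Xp × Xm)).injective (Prod.ext h1 h2)

theorem eq_add_inclNeg [NormedAddCommGroup Xp] [NormedAddCommGroup Xm]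
    {u w : Space Xp Xm} (h : u.fst = w.fst) :
    u = w + inclNeg (u.snd - w.snd) :=
  space_ext (by simp [h]) (by simp)

variable [NormedAddCommGroup Xp] [InnerProductSpace ℝ Xp]
  [NormedAddCommGroup Xm] [NormedSpace ℝ Xm]

/-- The inclusion of `X⁺` into `X` as a continuous linear map. -/
def inclPosCLM : Xp →L[ℝ] Space Xp Xm :=
  (WithLp.prodContinuousLinearEquiv 2 ℝ Xp Xm).symm.toContinuousLinearMap.comp
    (ContinuousLinearMap.inl ℝ Xp Xm)

theorem inclPosCLM_apply (x : Xp) : (inclPosCLM x : Space Xp Xm) = inclPos x := rfl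

@[simp] theorem inclPosCLM_fst (x : Xp) : (inclPosCLM x : Space Xp Xm).fst = x := rfl

variable {I : Space Xp Xm → ℝ}

theorem hasFDerivAt_energy (hI : ContDiff ℝ 1 I) (u : Space Xp Xm) :
    HasFDerivAt (energy I)
      ((innerSL ℝ u.fst).comp (WithLp.fstL 2 ℝ Xp Xm) - fderiv ℝ I u) u := by
  have h1 : HasFDerivAt I (fderiv ℝ I u) u := (hI.differentiable (by norm_num) u).hasFDerivAt
  have h2 : HasFDerivAt (fun w : Space Xp Xm => w.fst) (WithLp.fstL 2 ℝ Xp Xm) u :=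
    (WithLp.fstL 2 ℝ Xp Xm).hasFDerivAt
  have h3 := (h2.norm_sq.const_mul (1 / 2)).sub h1
  refine h3.congr_fderiv ?_
  ext h
  simp

theorem fderiv_energy_apply (hI : ContDiff ℝ 1 I) (u h : Space Xp Xm) :
    fderiv ℝ (energy I) u h = inner ℝ u.fst h.fst - fderiv ℝ I u h := by
  rw [(hasFDerivAt_energy hI u).fderiv]
  rfl

theorem contDiff_energy (hI : ContDiff ℝ 1 I) : ContDiff ℝ 1 (energy I) := by
  have h2 : ContDiff ℝ 1 (fun w : Space Xp Xm => w.fst) := (WithLp.fstL 2 ℝ Xp Xm).contDiff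
  exact (contDiff_const.mul (h2.norm_sq ℝ)).sub hI

theorem mem_constraintSet_iff (hI : ContDiff ℝ 1 I) {u : Space Xp Xm} :
    u ∈ constraintSet I ↔ ∀ v : Xm, fderiv ℝ I u (inclNeg v) = 0 := by
  refine forall_congr' fun v => ?_
  simp [fderiv_energy_apply hI]

/-- The assumptions under which `𝒥` can be reduced to `X⁺`. -/
structure IsReducible (I : Space Xp Xm → ℝ) : Prop where
  reflexive : IsReflexiveSpace Xm
  contDiff : ContDiff ℝ 1 I
  nonneg : ∀ u, 0 ≤ I u
  lsc : ∀ (u : ℕ → Space Xp Xm) (w : Space Xp Xm), TTendsto u w →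
    (I w : EReal) ≤ liminf (fun n => (I (u n) : EReal)) atTop
  tendsto : ∀ (u : ℕ → Space Xp Xm) (w : Space Xp Xm), TTendsto u w →
    Tendsto (fun n => I (u n)) atTop (𝓝 (I w)) → Tendsto u atTop (𝓝 w)
  coercive : Tendsto (fun u : Space Xp Xm => ‖u.fst‖ + I u) (comap norm atTop) atTop
  strict : ∀ u ∈ constraintSet I, ∀ v : Xm, v ≠ 0 → I u < I (u + inclNeg v)

namespace IsReducible

theorem exists_TTendsto_subseq (hI : IsReducible I) {u : ℕ → Space Xp Xm} {x : Xp} {C : ℝ}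
    (hx : Tendsto (fun n => (u n).fst) atTop (𝓝 x)) (hC : ∀ n, I (u n) ≤ C) :
    ∃ (w : Space Xp Xm) (k : ℕ → ℕ), StrictMono k ∧ w.fst = x ∧ TTendsto (u ∘ k) w := by
  obtain ⟨B, hB⟩ := hx.norm.bddAbove_range
  have hB' : ∀ n, ‖(u n).fst‖ ≤ B := fun n => hB ⟨n, rfl⟩
  obtain ⟨s, hs, hsub⟩ := mem_comap.1 (hI.coercive.eventually_gt_atTop (B + C))
  obtain ⟨R, hR⟩ := mem_atTop_sets.1 hs
  have hbd : ∀ n, ‖(u n).snd‖ ≤ R := fun n => by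
    refine (WithLp.norm_snd_le _ (u n)).trans ?_
    by_contra! h
    have h1 : B + C < ‖(u n).fst‖ + I (u n) := hsub (hR _ h.le)
    linarith [hB' n, hC n]
  obtain ⟨v, k, hk, hv⟩ := exists_weakly_convergent_subseq hI.reflexive hbd
  exact ⟨WithLp.toLp 2 (x, v), k, hk, rfl, hx.comp hk.tendsto_atTop, hv⟩

theorem le_of_TTendsto (hI : IsReducible I) {u : ℕ → Space Xp Xm} {w : Space Xp Xm}
    (hu : TTendsto u w) {C : ℕ → ℝ} {L : ℝ} (hC : ∀ n, I (u n) ≤ C n)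
    (hL : Tendsto C atTop (𝓝 L)) : I w ≤ L := by
  have h1 : Tendsto (fun n => (C n : EReal)) atTop (𝓝 (L : EReal)) := EReal.tendsto_coe.2 hL
  have h2 : liminf (fun n => (I (u n) : EReal)) atTop ≤ liminf (fun n => (C n : EReal)) atTop :=
    liminf_le_liminf (Eventually.of_forall fun n => EReal.coe_le_coe_iff.2 (hC n))
  rw [h1.liminf_eq] at h2
  exact EReal.coe_le_coe_iff.1 ((hI.lsc u w hu).trans h2)

/-- Direct method: (I4) bounds a minimizing sequence, reflexivity gives a `𝒯`-limit in the same
fibre, and (I2) passes to the limit. -/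
theorem exists_minimizer (hI : IsReducible I) (x : Xp) :
    ∃ w : Space Xp Xm, w.fst = x ∧ ∀ u : Space Xp Xm, u.fst = x → I w ≤ I u := by
  let A : Set ℝ := I '' {u | u.fst = x}
  have hbdd : BddBelow A := ⟨0, by rintro _ ⟨u, -, rfl⟩; exact hI.nonneg u⟩
  have hne : A.Nonempty := ⟨_, inclPos x, rfl, rfl⟩
  have hseq : ∀ n : ℕ, ∃ u : Space Xp Xm, u.fst = x ∧ I u ≤ sInf A + 1 / ((n : ℝ) + 1) := by
    intro n
    obtain ⟨_, ⟨u, hu, rfl⟩, hlt⟩ := exists_lt_of_csInf_lt hne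
      (lt_add_of_pos_right (sInf A) (Nat.one_div_pos_of_nat (α := ℝ) (n := n)))
    exact ⟨u, hu, hlt.le⟩
  choose u hux hu using hseq
  have hfst : Tendsto (fun n => (u n).fst) atTop (𝓝 x) := by simp [hux]
  obtain ⟨w, k, hk, hw, hT⟩ := hI.exists_TTendsto_subseq (C := sInf A + 1) hfst fun n => by
    refine (hu n).trans ?_
    have : 1 / ((n : ℝ) + 1) ≤ 1 := by
      rw [div_le_one (by positivity)]
      linarith [(Nat.cast_nonneg n : (0 : ℝ) ≤ n)]
    linarith
  refine ⟨w, hw, fun z hz => ?_⟩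
  have hlim : Tendsto (fun n => sInf A + 1 / ((k n : ℝ) + 1)) atTop (𝓝 (sInf A + 0)) :=
    (tendsto_one_div_add_atTop_nhds_zero_nat.comp hk.tendsto_atTop).const_add _
  have := hI.le_of_TTendsto hT (fun n => hu (k n)) hlim
  linarith [csInf_le hbdd ⟨z, hz, rfl⟩]

theorem mem_constraintSet_of_minimizer (hI : IsReducible I) {w : Space Xp Xm}
    (hw : ∀ u : Space Xp Xm, u.fst = w.fst → I w ≤ I u) : w ∈ constraintSet I := by
  rw [mem_constraintSet_iff hI.contDiff]
  intro v
  have h1 : HasDerivAt (fun t : ℝ => I (w + t • inclNeg v)) (fderiv ℝ I w (inclNeg v)) 0 :=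
    (hI.contDiff.differentiable (by norm_num) w).hasFDerivAt.hasLineDerivAt _
  refine IsLocalMin.hasDerivAt_eq_zero (Eventually.of_forall fun t => ?_) h1
  simpa using hw (w + t • inclNeg v) (by simp)

theorem lt_of_mem (hI : IsReducible I) {u w : Space Xp Xm} (hu : u ∈ constraintSet I)
    (h : w.fst = u.fst) (hne : w ≠ u) : I u < I w := by
  rw [eq_add_inclNeg h]
  refine hI.strict u hu _ fun h0 => hne ?_
  exact space_ext h (sub_eq_zero.1 h0)

theorem existsUnique (hI : IsReducible I) (x : Xp) :
    ∃! u, u ∈ constraintSet I ∧ u.fst = x := by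
  obtain ⟨w, hwx, hw⟩ := hI.exists_minimizer x
  subst hwx
  refine ⟨w, ⟨hI.mem_constraintSet_of_minimizer hw, rfl⟩, ?_⟩
  rintro u ⟨hu, hux⟩
  by_contra hne
  have h1 := hI.lt_of_mem hu hux.symm (Ne.symm hne)
  have h2 := hw u hux
  linarith

theorem lift_spec (hI : IsReducible I) (x : Xp) :
    lift I x ∈ constraintSet I ∧ (lift I x).fst = x :=
  Classical.epsilon_spec (hI.existsUnique x).exists

theorem lift_mem (hI : IsReducible I) (x : Xp) : lift I x ∈ constraintSet I := (hI.lift_spec x).1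

theorem lift_fst (hI : IsReducible I) (x : Xp) : (lift I x).fst = x := (hI.lift_spec x).2

theorem lift_eq (hI : IsReducible I) {u : Space Xp Xm} (hu : u ∈ constraintSet I) :
    lift I u.fst = u :=
  (hI.existsUnique u.fst).unique (hI.lift_spec _) ⟨hu, rfl⟩

theorem lift_le (hI : IsReducible I) {u : Space Xp Xm} {x : Xp} (h : u.fst = x) :
    I (lift I x) ≤ I u := by
  rcases eq_or_ne u (lift I x) with rfl | hne
  · exact le_rfl
  · exact (hI.lt_of_mem (hI.lift_mem x) (h.trans (hI.lift_fst x).symm) hne).le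

/-- The minimizers on nearby fibres have values at most `C n`, which tends to the minimum over the
fibre of `y`. A `𝒯`-limit is therefore `lift I y`; the values converge by (I2), and (I3) upgrades
the convergence to norm. -/
theorem continuous_lift (hI : IsReducible I) : Continuous (lift I) := by
  refine continuous_iff_seqContinuous.2 fun x y hxy => tendsto_of_subseq_tendsto fun ns hns => ?_
  have hy : Tendsto (fun n => x (ns n)) atTop (𝓝 y) := hxy.comp hns
  -- The competitor is the translate of `lift I y` into the fibre of `x (ns n)`.
  let C : ℕ → ℝ := fun n => I (lift I y + inclPosCLM (x (ns n) - y))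
  have hC : Tendsto C atTop (𝓝 (I (lift I y))) := by
    have h1 : Continuous fun z : Xp => I (lift I y + inclPosCLM (z - y)) := by
      have := hI.contDiff.continuous
      fun_prop
    simpa [C, Function.comp_def] using (h1.tendsto y).comp hy
  have hle : ∀ n, I (lift I (x (ns n))) ≤ C n := fun n => hI.lift_le (by simp [hI.lift_fst])
  obtain ⟨B, hB⟩ := hC.bddAbove_range
  obtain ⟨w, k, hk, hw, hT⟩ := hI.exists_TTendsto_subseq
    (u := fun n => lift I (x (ns n))) (x := y) (C := B)
    (by simpa only [hI.lift_fst] using hy) fun n => (hle n).trans (hB ⟨n, rfl⟩)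
  have hCk : Tendsto (fun n => C (k n)) atTop (𝓝 (I (lift I y))) := hC.comp hk.tendsto_atTop
  have hwle : I w ≤ I (lift I y) := hI.le_of_TTendsto hT (fun n => hle (k n)) hCk
  have hwy : w = lift I y := by
    by_contra hne
    exact (hI.lt_of_mem (hI.lift_mem y) (hw.trans (hI.lift_fst y).symm) hne).not_ge hwle
  subst hwy
  refine ⟨k, hI.tendsto _ _ hT ?_⟩
  rw [← EReal.tendsto_coe]
  refine tendsto_of_le_liminf_of_limsup_le (hI.lsc _ _ hT) ?_
  have h1 : Tendsto (fun n => (C (k n) : EReal)) atTop (𝓝 (I (lift I y) : EReal)) :=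
    EReal.tendsto_coe.2 hCk
  rw [← h1.limsup_eq]
  exact limsup_le_limsup (Eventually.of_forall fun n => EReal.coe_le_coe_iff.2 (hle (k n)))

/-- Envelope argument: translating each of the two minimizers into the other's fibre bounds the
increment from above and below by increments of `I` along `inclPosCLM (y - x)`. Strict
differentiability at `lift I x` and continuity of `lift I` give both the same linear part. -/
theorem hasFDerivAt_comp_lift (hI : IsReducible I) (x : Xp) :
    HasFDerivAt (fun y => I (lift I y)) ((fderiv ℝ I (lift I x)).comp inclPosCLM) x := by
  have hstrict : HasStrictFDerivAt I (fderiv ℝ I (lift I x)) (lift I x) :=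
    hI.contDiff.contDiffAt.hasStrictFDerivAt (by norm_num)
  have hlift : Tendsto (lift I) (𝓝 x) (𝓝 (lift I x)) := hI.continuous_lift.tendsto x
  have hincl : Tendsto (fun y => inclPosCLM (y - x)) (𝓝 x) (𝓝 (0 : Space Xp Xm)) := by
    have h : Continuous fun y : Xp => (inclPosCLM (y - x) : Space Xp Xm) := by fun_prop
    simpa using h.tendsto x
  have hO : (fun y => (inclPosCLM (y - x) : Space Xp Xm)) =O[𝓝 x] fun y => y - x :=
    ContinuousLinearMap.isBigO_comp _ _ _
  have h1 := hstrict.isLittleO.comp_tendsto (show Tendsto (fun y =>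
      (lift I x + inclPosCLM (y - x), lift I x)) (𝓝 x) (𝓝 (lift I x, lift I x)) by
    simpa using (tendsto_const_nhds.add hincl).prodMk_nhds (tendsto_const_nhds (x := lift I x)))
  have h2 := hstrict.isLittleO.comp_tendsto (show Tendsto (fun y =>
      (lift I y, lift I y - inclPosCLM (y - x))) (𝓝 x) (𝓝 (lift I x, lift I x)) by
    simpa using hlift.prodMk_nhds (hlift.sub hincl))
  have h1' := h1.trans_isBigO (k := fun y => y - x) (by simpa [Function.comp_def] using hO)
  have h2' := h2.trans_isBigO (k := fun y => y - x) (by simpa [Function.comp_def] using hO)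
  refine HasFDerivAt.of_isLittleO ((Asymptotics.IsBigO.of_norm_le fun y => ?_).trans_isLittleO
    (h1'.norm_left.add h2'.norm_left))
  have hle1 : I (lift I y) ≤ I (lift I x + inclPosCLM (y - x)) :=
    hI.lift_le (by simp [hI.lift_fst])
  have hle2 : I (lift I x) ≤ I (lift I y - inclPosCLM (y - x)) :=
    hI.lift_le (by simp [hI.lift_fst])
  simp only [Function.comp, add_sub_cancel_left, sub_sub_cancel, Real.norm_eq_abs,
    ContinuousLinearMap.comp_apply]
  set D := fderiv ℝ I (lift I x) (inclPosCLM (y - x))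
  rw [abs_le]
  constructor
  · linarith [neg_abs_le (I (lift I y) - I (lift I y - inclPosCLM (y - x)) - D),
      abs_nonneg (I (lift I x + inclPosCLM (y - x)) - I (lift I x) - D)]
  · linarith [le_abs_self (I (lift I x + inclPosCLM (y - x)) - I (lift I x) - D),
      abs_nonneg (I (lift I y) - I (lift I y - inclPosCLM (y - x)) - D)]

theorem hasFDerivAt_reduced (hI : IsReducible I) (x : Xp) :
    HasFDerivAt (reduced I) ((fderiv ℝ (energy I) (lift I x)).comp inclPosCLM) x := by
  have h1 : reduced I = fun y => 1 / 2 * ‖y‖ ^ 2 - I (lift I y) := by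
    ext y
    simp [reduced, energy, hI.lift_fst]
  rw [h1]
  refine (((hasFDerivAt_id x).norm_sq.const_mul (1 / 2)).sub
    (hI.hasFDerivAt_comp_lift x)).congr_fderiv ?_
  ext h
  simp [fderiv_energy_apply hI.contDiff, hI.lift_fst]

theorem contDiff_reduced (hI : IsReducible I) : ContDiff ℝ 1 (reduced I) := by
  rw [contDiff_one_iff_fderiv]
  refine ⟨fun x => (hI.hasFDerivAt_reduced x).differentiableAt, ?_⟩
  have h1 : fderiv ℝ (reduced I) = fun x => (fderiv ℝ (energy I) (lift I x)).comp inclPosCLM :=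
    funext fun x => (hI.hasFDerivAt_reduced x).fderiv
  rw [h1]
  exact (((contDiff_energy hI.contDiff).continuous_fderiv (by norm_num)).comp
    hI.continuous_lift).clm_comp continuous_const

theorem energy_le_reduced (hI : IsReducible I) {u : Space Xp Xm} {x : Xp} (h : u.fst = x) :
    energy I u ≤ reduced I x := by
  simp only [reduced, energy, hI.lift_fst, h]
  linarith [hI.lift_le h]

end IsReducible

end Reduction

/-- The minimum over `[p, q]` is not at `p`, where `f` decreases, nor at `q`, where `f` is larger
than at `p`. -/
theorem exists_interior_min {f f' : ℝ → ℝ} (hf : ∀ t, HasDerivAt f (f' t) t) {p q : ℝ}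
    (hpq : p < q) (hlt : f p < f q) (hp : f' p < 0) :
    ∃ s, p < s ∧ s < q ∧ f' s = 0 ∧ f s ≤ f p := by
  have hc : Continuous f := continuous_iff_continuousAt.2 fun t => (hf t).continuousAt
  obtain ⟨s, ⟨hps, hsq⟩, hs⟩ := isCompact_Icc.exists_isMinOn ⟨p, Set.left_mem_Icc.2 hpq.le⟩
    hc.continuousOn
  have hsp : f s ≤ f p := hs (Set.left_mem_Icc.2 hpq.le)
  have hsq' : s < q := lt_of_le_of_ne hsq fun h => by rw [h] at hsp; linarith
  have hps' : p < s := by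
    refine lt_of_le_of_ne hps fun h => ?_
    subst h
    have h1 := (hs.localize (s := Set.Icc p q)).hasFDerivWithinAt_nonneg
      (hf p).hasFDerivAt.hasFDerivWithinAt (y := q - p)
      (sub_mem_posTangentConeAt_of_segment_subset (by rw [segment_eq_Icc hpq.le]))
    have h2 : (q - p) * f' p < 0 := mul_neg_of_pos_of_neg (by linarith) hp
    simp at h1
    linarith
  exact ⟨s, hps', hsq', (hs.isLocalMin (Icc_mem_nhds hps' hsq')).hasDerivAt_eq_zero (hf s), hsp⟩

/-! ### The Nehari set, rays and admissible paths. -/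

section Nehari

variable {Xp Xm : Type*} [NormedAddCommGroup Xp] [InnerProductSpace ℝ Xp]
  [NormedAddCommGroup Xm] [NormedSpace ℝ Xm] {I : Space Xp Xm → ℝ}

namespace IsReducible

theorem lift_zero (hI : IsReducible I) (h0 : I 0 = 0) : lift I 0 = 0 :=
  hI.lift_eq (hI.mem_constraintSet_of_minimizer fun u _ => h0.trans_le (hI.nonneg u))

theorem reduced_zero (hI : IsReducible I) (h0 : I 0 = 0) : reduced I 0 = 0 := by
  simp [reduced, energy, hI.lift_zero h0, h0]

theorem reduced_fst (hI : IsReducible I) {u : Space Xp Xm} (hu : u ∈ constraintSet I) :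
    reduced I u.fst = energy I u := by
  rw [reduced, hI.lift_eq hu]

theorem sphereInf_le_reduced (hI : IsReducible I) {r : ℝ} {x : Xp} (hx : ‖x‖ = r) :
    sphereInf I r ≤ (reduced I x : EReal) :=
  (iInf₂_le x hx).trans (EReal.coe_le_coe_iff.2 (hI.energy_le_reduced rfl))

theorem reduced_pos (hI : IsReducible I) {r : ℝ} (ha : 0 < sphereInf I r) {x : Xp}
    (hx : ‖x‖ = r) : 0 < reduced I x :=
  EReal.coe_pos.1 (ha.trans_le (hI.sphereInf_le_reduced hx))

theorem continuous_reduced (hI : IsReducible I) : Continuous (reduced I) :=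
  hI.contDiff_reduced.continuous

theorem mem_nehariSet_of_fderiv_eq_zero (hI : IsReducible I) {x : Xp} (hx : x ≠ 0)
    (h : fderiv ℝ (reduced I) x x = 0) : lift I x ∈ nehariSet I := by
  refine ⟨by rwa [hI.lift_fst], fun s v => ?_⟩
  have h1 : fderiv ℝ (energy I) (lift I x) (inclPosCLM x) = 0 := by
    rwa [(hI.hasFDerivAt_reduced x).fderiv] at h
  have h2 : lift I x = inclPosCLM x + inclNeg (lift I x).snd :=
    space_ext (by simp [hI.lift_fst]) (by simp [inclPosCLM_apply, inclPos])
  have h3 := hI.lift_mem x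
  have h4 : fderiv ℝ (energy I) (lift I x) (lift I x) = 0 := by
    rw [congrArg (fderiv ℝ (energy I) (lift I x)) h2, map_add, h1, h3, add_zero]
  rw [map_add, map_smul, h4, h3]
  simp

theorem hasDerivAt_ray (hI : IsReducible I) (x : Xp) (t : ℝ) :
    HasDerivAt (fun s : ℝ => reduced I (s • x)) (fderiv ℝ (reduced I) (t • x) x) t := by
  have h1 : HasDerivAt (fun s : ℝ => s • x) x t := by
    simpa using (hasDerivAt_id t).smul_const x
  exact (hI.contDiff_reduced.differentiable (by norm_num) (t • x)).hasFDerivAt.comp_hasDerivAt t h1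

theorem mem_nehariSet_of_ray (hI : IsReducible I) {x : Xp} (hx : x ≠ 0) {t : ℝ} (ht : 0 < t)
    (h : fderiv ℝ (reduced I) (t • x) x = 0) : lift I (t • x) ∈ nehariSet I :=
  hI.mem_nehariSet_of_fderiv_eq_zero (smul_ne_zero ht.ne' hx) (by rw [map_smul, h, smul_zero])

end IsReducible

/-- The inequality that makes every point of `𝒩` a maximizer on its half-space. -/
def NehariInequality (I : Space Xp Xm → ℝ) : Prop :=
  ∀ u ∈ nehariSet I, ∀ t : ℝ, 0 ≤ t → ∀ v : Xm,
    (t ^ 2 - 1) / 2 * fderiv ℝ I u u + t * fderiv ℝ I u (inclNeg v)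
      + I u - I (t • u + inclNeg v) ≤ 0

/-- On `𝒩`, `I'(u)[u] = ‖u⁺‖²` and `I'(u)` vanishes on `X⁻`, so (I8) is exactly this comparison of
energies. -/
theorem NehariInequality.energy_le (hN : NehariInequality I) (hI : IsReducible I)
    {u w : Space Xp Xm} (hu : u ∈ nehariSet I) {t : ℝ} (ht : 0 ≤ t) (hw : w.fst = t • u.fst) :
    energy I w ≤ energy I u := by
  have h0 : (inclNeg 0 : Space Xp Xm) = 0 := rfl
  have h1 : fderiv ℝ I u u = ‖u.fst‖ ^ 2 := by
    have h := hu.2 1 0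
    rw [one_smul, h0, add_zero, fderiv_energy_apply hI.contDiff, real_inner_self_eq_norm_sq] at h
    linarith
  have h2 : ∀ v, fderiv ℝ I u (inclNeg v) = 0 := fun v => by
    have h := hu.2 0 v
    rw [zero_smul, zero_add, fderiv_energy_apply hI.contDiff, inclNeg_fst, inner_zero_right] at h
    linarith
  have h3 := hN u hu t ht (w.snd - (t • u).snd)
  rw [← eq_add_inclNeg (by simpa using hw), h1, h2] at h3
  simp only [energy, hw, norm_smul, Real.norm_of_nonneg ht]
  nlinarith

theorem NehariInequality.reduced_le (hN : NehariInequality I) (hI : IsReducible I)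
    {x : Xp} (hx : lift I x ∈ nehariSet I) {t : ℝ} (ht : 0 ≤ t) :
    reduced I (t • x) ≤ reduced I x :=
  hN.energy_le hI hx ht (by simp [hI.lift_fst])

theorem NehariInequality.reduced_ray_le (hN : NehariInequality I) (hI : IsReducible I)
    {x : Xp} (hx : x ≠ 0) {s : ℝ} (hs : 0 < s) (h : fderiv ℝ (reduced I) (s • x) x = 0)
    {t : ℝ} (ht : 0 ≤ t) : reduced I (t • x) ≤ reduced I (s • x) := by
  have h1 := hN.reduced_le hI (hI.mem_nehariSet_of_ray hx hs h) (t := t / s) (by positivity)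
  rwa [smul_smul, div_mul_cancel₀ _ hs.ne'] at h1

/-- Otherwise the ray has an interior minimum between `x` and `T • x`. That is a point of `𝒩`, hence
also a maximum on the ray, yet it lies below the value at `T • x`. -/
theorem NehariInequality.fderiv_nonneg (hN : NehariInequality I) (hI : IsReducible I)
    {x : Xp} (hx : x ≠ 0) {T : ℝ} (hT : 1 < T) (hlt : reduced I x < reduced I (T • x)) :
    0 ≤ fderiv ℝ (reduced I) x x := by
  by_contra! h
  obtain ⟨s, hs1, -, hs, hle⟩ := exists_interior_min (hI.hasDerivAt_ray x) hT
    (by simpa using hlt) (by simpa using h)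
  have h1 := hN.reduced_ray_le hI hx (by linarith) hs (t := T) (by linarith)
  simp only [one_smul] at hle
  linarith

/-- A critical point on a ray maximizes there, so its value is at least `reduced I 0 = 0`. A
nonnegative slope at `x` would give one of negative value, at `x` itself or between `0` and `x`. -/
theorem NehariInequality.fderiv_neg (hN : NehariInequality I) (hI : IsReducible I)
    (h0 : I 0 = 0) {x : Xp} (hx : reduced I x < 0) : fderiv ℝ (reduced I) x x < 0 := by
  have hx0 : x ≠ 0 := by
    rintro rfl
    exact hx.ne (hI.reduced_zero h0)
  have hcrit : ∀ s : ℝ, 0 < s → fderiv ℝ (reduced I) (s • x) x = 0 → 0 ≤ reduced I (s • x) := by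
    intro s hs h
    simpa [hI.reduced_zero h0] using hN.reduced_ray_le hI hx0 hs h le_rfl
  by_contra! h
  rcases h.eq_or_lt with h | h
  · have := hcrit 1 one_pos (by simpa using h.symm)
    rw [one_smul] at this
    linarith
  · have hd : ∀ t : ℝ, HasDerivAt (fun t : ℝ => reduced I ((1 - t) • x))
        (-fderiv ℝ (reduced I) ((1 - t) • x) x) t := fun t =>
      (hI.hasDerivAt_ray x (1 - t)).comp_const_sub 1 t
    obtain ⟨s, -, hs1, hs, hle⟩ := exists_interior_min hd one_pos
      (by simpa [hI.reduced_zero h0] using hx) (by simpa using h)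
    have h1 := hcrit (1 - s) (by linarith) (neg_eq_zero.1 hs)
    simp only [sub_zero, one_smul] at hle
    linarith

/-- A path in `ℳ` that belongs to `Γ` meets `𝒩`. -/
theorem NehariInequality.exists_mem_nehariSet (hN : NehariInequality I) (hI : IsReducible I)
    (h0 : I 0 = 0) {r : ℝ} (hr : 0 < r) (ha : 0 < sphereInf I r)
    {γ : C(unitInterval, Space Xp Xm)} (hγ : γ ∈ paths I r) : ∃ t, γ t ∈ nehariSet I := by
  obtain ⟨hγM, hγ0, hγr, hγ1⟩ := hγ
  obtain ⟨a, ha0, har⟩ := EReal.lt_iff_exists_real_btwn.1 ha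
  have ha0' : 0 < a := EReal.coe_pos.1 ha0
  have hsph : ∀ x : Xp, ‖x‖ = r → a < reduced I x := fun x hx =>
    EReal.coe_lt_coe_iff.1 (har.trans_le (hI.sphereInf_le_reduced hx))
  have hnear : ∀ᶠ x in 𝓝 (0 : Xp), reduced I x < a :=
    hI.continuous_reduced.continuousAt.eventually_lt_const (by rwa [hI.reduced_zero h0])
  obtain ⟨δ, hδ, hball⟩ := Metric.eventually_nhds_iff.1 hnear
  -- On the sphere of radius `ρ` the values lie below `a`, which is exceeded on the sphere of radius
  -- `r`; `fderiv_nonneg` then applies.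
  let ρ := min (δ / 2) (r / 2)
  have hρ : 0 < ρ := lt_min (by linarith) (by linarith)
  have hρr : ρ < r := (min_le_right _ _).trans_lt (by linarith)
  have hsmall : ∀ x : Xp, ‖x‖ = ρ → 0 ≤ fderiv ℝ (reduced I) x x := by
    intro x hx
    have hx0 : 0 < ‖x‖ := hx ▸ hρ
    refine hN.fderiv_nonneg hI (norm_pos_iff.1 hx0) (T := r / ‖x‖)
      (by rw [one_lt_div hx0, hx]; exact hρr) ?_
    refine (hball ?_).trans (hsph _ ?_)
    · rw [dist_zero_right, hx]
      exact (min_le_left _ _).trans_lt (by linarith)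
    · rw [norm_smul, Real.norm_of_nonneg (by positivity), div_mul_cancel₀ _ hx0.ne']
  have hfst : Continuous fun t => (γ t).fst :=
    (WithLp.fstL 2 ℝ Xp Xm).continuous.comp γ.continuous
  -- The radial derivative also vanishes at the origin; the second term excludes the ball of radius
  -- `ρ`. At a zero of `F` with `‖(γ t).fst‖ = ρ`, the sign on that sphere still forces the
  -- derivative to vanish.
  let F : unitInterval → ℝ := fun t =>
    max (fderiv ℝ (reduced I) (γ t).fst (γ t).fst) (ρ - ‖(γ t).fst‖)
  have hF : Continuous F := by
    have h1 : Continuous fun t => fderiv ℝ (reduced I) (γ t).fst :=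
      (hI.contDiff_reduced.continuous_fderiv (by norm_num)).comp hfst
    exact (h1.clm_apply hfst).max (by fun_prop)
  have hF0 : 0 ≤ F 0 := le_max_of_le_right (by simp [hγ0, hρ.le])
  have hF1 : F 1 ≤ 0 := by
    refine max_le (hN.fderiv_neg hI h0 ?_).le (by linarith)
    rwa [hI.reduced_fst (hγM 1)]
  obtain ⟨t, ht⟩ := mem_range_of_exists_le_of_exists_ge hF ⟨1, hF1⟩ ⟨0, hF0⟩
  refine ⟨t, ?_⟩
  have h1 : fderiv ℝ (reduced I) (γ t).fst (γ t).fst ≤ 0 := (le_max_left _ _).trans ht.le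
  have h2 : ρ - ‖(γ t).fst‖ ≤ 0 := (le_max_right _ _).trans ht.le
  have h3 : fderiv ℝ (reduced I) (γ t).fst (γ t).fst = 0 := by
    rcases max_choice (fderiv ℝ (reduced I) (γ t).fst (γ t).fst) (ρ - ‖(γ t).fst‖) with h | h
    · exact h.symm.trans ht
    · have h4 : ρ - ‖(γ t).fst‖ = 0 := h.symm.trans ht
      exact le_antisymm h1 (hsmall _ (by linarith))
  have h4 : (γ t).fst ≠ 0 := norm_pos_iff.1 (by linarith)
  have h5 := hI.mem_nehariSet_of_fderiv_eq_zero h4 h3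
  rwa [hI.lift_eq (hγM t)] at h5

namespace IsReducible

theorem eventually_reduced_neg (hI : IsReducible I) {x : Xp}
    (hx : Tendsto (fun t : ℝ => I (lift I (t • x)) / t ^ 2) atTop atTop) :
    ∀ᶠ t : ℝ in atTop, reduced I (t • x) < 0 := by
  filter_upwards [hx.eventually_gt_atTop (1 / 2 * ‖x‖ ^ 2), eventually_gt_atTop 0] with t h1 h2
  rw [lt_div_iff₀ (by positivity)] at h1
  simp only [reduced, energy, hI.lift_fst, norm_smul, Real.norm_of_nonneg h2.le]
  linarith [mul_pow t ‖x‖ 2]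

theorem exists_ray_max (hI : IsReducible I) (h0 : I 0 = 0) {r : ℝ} (hr : 0 < r)
    (ha : 0 < sphereInf I r) {x : Xp} (hx : x ≠ 0)
    (hneg : ∀ᶠ t : ℝ in atTop, reduced I (t • x) < 0) :
    ∃ t : ℝ, 0 < t ∧ lift I (t • x) ∈ nehariSet I := by
  obtain ⟨T, hT⟩ := eventually_atTop.1 hneg
  have hx0 : 0 < ‖x‖ := norm_pos_iff.2 hx
  -- The interval reaches the sphere of radius `r`, where the value is positive, and ends where it
  -- is negative, so the maximum is interior.
  let R := max T (r / ‖x‖)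
  have hrx : 0 < r / ‖x‖ := by positivity
  have hc : Continuous fun t : ℝ => reduced I (t • x) := by
    have := hI.continuous_reduced
    fun_prop
  have hmem : r / ‖x‖ ∈ Set.Icc 0 R := ⟨hrx.le, le_max_right _ _⟩
  obtain ⟨s, ⟨hs0, hsR⟩, hs⟩ := isCompact_Icc.exists_isMaxOn ⟨_, hmem⟩ hc.continuousOn
  have hpos : 0 < reduced I (s • x) := by
    refine (hI.reduced_pos ha ?_).trans_le (hs hmem)
    rw [norm_smul, Real.norm_of_nonneg hrx.le, div_mul_cancel₀ _ hx0.ne']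
  have hs0' : 0 < s := by
    refine lt_of_le_of_ne hs0 fun h => ?_
    rw [← h, zero_smul, hI.reduced_zero h0] at hpos
    exact lt_irrefl _ hpos
  have hsR' : s < R := by
    refine lt_of_le_of_ne hsR fun h => ?_
    have := hT s (h ▸ le_max_left _ _)
    linarith
  exact ⟨s, hs0', hI.mem_nehariSet_of_ray hx hs0'
    ((hs.isLocalMax (Icc_mem_nhds hs0' hsR')).hasDerivAt_eq_zero (hI.hasDerivAt_ray x s))⟩

/-- The image under `m` of a path in `X⁺`. -/
noncomputable def liftPath (hI : IsReducible I) (σ : C(unitInterval, Xp)) :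
    C(unitInterval, Space Xp Xm) :=
  ⟨fun t => lift I (σ t), hI.continuous_lift.comp σ.continuous⟩

@[simp] theorem liftPath_apply (hI : IsReducible I) (σ : C(unitInterval, Xp))
    (t : unitInterval) : hI.liftPath σ t = lift I (σ t) := rfl

theorem liftPath_mem (hI : IsReducible I) (h0 : I 0 = 0) {r : ℝ} {σ : C(unitInterval, Xp)}
    (hσ0 : σ 0 = 0) (hσr : r < ‖σ 1‖) (hσ1 : reduced I (σ 1) < 0) :
    hI.liftPath σ ∈ paths I r :=
  ⟨fun t => hI.lift_mem _, by simp [hσ0, hI.lift_zero h0], by simpa [hI.lift_fst], hσ1⟩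

theorem exists_ray_path (hI : IsReducible I) (h0 : I 0 = 0) (r : ℝ) {x : Xp} (hx : x ≠ 0)
    (hneg : ∀ᶠ t : ℝ in atTop, reduced I (t • x) < 0) :
    ∃ R : ℝ, 0 < R ∧
      hI.liftPath ⟨fun t : unitInterval => ((t : ℝ) * R) • x, by fun_prop⟩ ∈ paths I r := by
  have hx0 : 0 < ‖x‖ := norm_pos_iff.2 hx
  obtain ⟨R, hR1, hR2, hR3⟩ :=
    (hneg.and ((eventually_gt_atTop (r / ‖x‖)).and (eventually_gt_atTop 0))).exists
  refine ⟨R, hR3, hI.liftPath_mem h0 (by simp) ?_ (by simpa using hR1)⟩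
  rw [div_lt_iff₀ hx0] at hR2
  simpa [norm_smul, abs_of_pos hR3] using hR2

/-- Each path crosses `‖u⁺‖ = r`, and `m(x)` maximizes `energy I` on a fibre that contains `inclPos
x`. -/
theorem sphereInf_le_mountainPassLevel (hI : IsReducible I) {r : ℝ} (hr : 0 < r) :
    sphereInf I r ≤ mountainPassLevel I r := by
  refine le_iInf₂ fun γ hγ => ?_
  obtain ⟨hγM, hγ0, hγr, -⟩ := hγ
  have hfst : Continuous fun t => ‖(γ t).fst‖ :=
    ((WithLp.fstL 2 ℝ Xp Xm).continuous.comp γ.continuous).norm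
  obtain ⟨t, ht⟩ := mem_range_of_exists_le_of_exists_ge hfst
    ⟨0, by simpa [hγ0] using hr.le⟩ ⟨1, hγr.le⟩
  refine (hI.sphereInf_le_reduced ht).trans ?_
  rw [hI.reduced_fst (hγM t)]
  exact le_iSup (fun t => (energy I (γ t) : EReal)) t

theorem exists_ceramiSeq [CompleteSpace Xp] (hI : IsReducible I) (h0 : I 0 = 0) {r c : ℝ}
    (hc0 : 0 < c) (hc : (c : EReal) = mountainPassLevel I r) :
    ∃ u : ℕ → Xp, IsCeramiSeq (reduced I) c u := by
  have hstep : ∀ n : ℕ, ∃ x, c ≤ reduced I x ∧ reduced I x ≤ c + 1 / ((n : ℝ) + 1) ∧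
      (1 + ‖x‖) * ‖fderiv ℝ (reduced I) x‖ ≤ 3 * (1 / ((n : ℝ) + 1)) := by
    intro n
    have hε : 0 < 1 / ((n : ℝ) + 1) := Nat.one_div_pos_of_nat
    have hlt : mountainPassLevel I r < ((c + 1 / ((n : ℝ) + 1) : ℝ) : EReal) := by
      rw [← hc]
      exact EReal.coe_lt_coe_iff.2 (by linarith)
    simp only [mountainPassLevel, minimax, iInf_lt_iff] at hlt
    obtain ⟨γ, hγ, hlt⟩ := hlt
    obtain ⟨hγM, hγ0, hγr, hγ1⟩ := hγ
    let γ₀ : C(unitInterval, Xp) :=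
      ⟨fun t => (γ t).fst, (WithLp.fstL 2 ℝ Xp Xm).continuous.comp γ.continuous⟩
    have hval : ∀ t, reduced I (γ₀ t) = energy I (γ t) := fun t => hI.reduced_fst (hγM t)
    have hγ₀0 : γ₀ 0 = 0 := congrArg WithLp.fst hγ0
    refine exists_almost_critical hI.contDiff_reduced hε γ₀ (fun t => ?_) ?_ ?_ ?_
    · rw [hval]
      exact EReal.coe_le_coe_iff.1
        ((le_iSup (fun t => (energy I (γ t) : EReal)) t).trans hlt.le)
    · rwa [hγ₀0, hI.reduced_zero h0]
    · rw [hval]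
      exact hγ1.trans hc0
    -- Membership in `Γ` constrains a lifted path only at its end points, so every competitor with
    -- the same ends is admissible.
    · intro σ hσ0 hσ1
      have hσmem : hI.liftPath σ ∈ paths I r :=
        hI.liftPath_mem h0 (hσ0.trans hγ₀0) (by rw [hσ1]; exact hγr)
          (by rw [hσ1, hval]; exact hγ1)
      obtain ⟨t, -, ht⟩ := isCompact_univ.exists_isMaxOn ⟨(0 : unitInterval), trivial⟩
        (hI.continuous_reduced.comp σ.continuous).continuousOn
      refine ⟨t, EReal.coe_le_coe_iff.1 (hc.trans_le ((iInf₂_le _ hσmem).trans ?_))⟩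
      exact iSup_le fun t' => EReal.coe_le_coe_iff.2 (ht (Set.mem_univ t'))
  choose u hu1 hu2 hu3 using hstep
  have hε : Tendsto (fun n : ℕ => 1 / ((n : ℝ) + 1)) atTop (𝓝 0) :=
    tendsto_one_div_add_atTop_nhds_zero_nat
  refine ⟨u, ?_, ?_⟩
  · refine squeeze_zero_norm (fun n => ?_) (by simpa only [mul_zero] using hε.const_mul 3)
    rw [norm_smul, Real.norm_of_nonneg (by positivity)]
    exact hu3 n
  · exact tendsto_of_tendsto_of_tendsto_of_le_of_le tendsto_const_nhds
      (by simpa using hε.const_add c) hu1 hu2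

end IsReducible

end Nehari

/-! ### Comparison of the levels. -/

theorem theorem2p1 {Xp Xm : Type*}
    [NormedAddCommGroup Xp] [InnerProductSpace ℝ Xp] [CompleteSpace Xp]
    [NormedAddCommGroup Xm] [NormedSpace ℝ Xm] [CompleteSpace Xm]
    (hX : IsReflexiveSpace (Space Xp Xm))
    (I : Space Xp Xm → ℝ) (r : ℝ) (Q : Submodule ℝ Xp)
    -- `ℐ` is of class `C¹` and `ℐ(u) ≥ ℐ(0) = 0`
    (hI1 : ContDiff ℝ 1 I ∧ I 0 = 0 ∧ ∀ u, 0 ≤ I u)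
    -- `𝒯`-sequential lower semicontinuity
    (hI2 : ∀ (u : ℕ → Space Xp Xm) (w : Space Xp Xm),
      TTendsto u w →
        (I w : EReal) ≤ liminf (fun n => (I (u n) : EReal)) atTop)
    -- `𝒯`-convergence with convergence of the values gives norm convergence
    (hI3 : ∀ (u : ℕ → Space Xp Xm) (w : Space Xp Xm),
      TTendsto u w → Tendsto (fun n => I (u n)) atTop (𝓝 (I w)) →
        Tendsto u atTop (𝓝 w))
    -- `‖u⁺‖ + ℐ(u) → ∞` as `‖u‖ → ∞`
    (hI4 : Tendsto (fun u : Space Xp Xm => ‖u.fst‖ + I u)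
      (comap norm atTop) atTop)
    -- points of `ℳ` are strict minimizers along `X⁻`
    (hI5 : ∀ u ∈ constraintSet I, ∀ v : Xm, v ≠ 0 →
      I u < I (u + inclNeg v))
    -- `r > 0` and `a > 0`
    (hI6 : 0 < r ∧ 0 < sphereInf I r)
    -- superquadraticity along the infinite-dimensional closed subspace `Q` of `X⁺`
    (hQ : IsClosed (Q : Set Xp) ∧ ¬ FiniteDimensional ℝ Q)
    (hI7 : ∀ (t : ℕ → ℝ) (x : ℕ → Xp) (y : Xp), Tendsto t atTop atTop → (∀ n, x n ∈ Q) →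
      Tendsto x atTop (𝓝 y) → y ≠ 0 →
        Tendsto (fun n => I (lift I (t n • x n)) / t n ^ 2) atTop atTop)
    -- the inequality on `𝒩`
    (hI8 : ∀ u ∈ nehariSet I, ∀ t : ℝ, 0 ≤ t → ∀ v : Xm,
      (t ^ 2 - 1) / 2 * fderiv ℝ I u u + t * fderiv ℝ I u (inclNeg v)
        + I u - I (t • u + inclNeg v) ≤ 0) :
    -- the map `m` and the reduced functional are well defined, the latter of class `C¹`
    (∀ x : Xp, ∃! u, u ∈ constraintSet I ∧ u.fst = x) ∧
    ContDiff ℝ 1 (reduced I) ∧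
    -- a Cerami sequence at the mountain pass level, which is a real number
    (∃ c : ℝ, (c : EReal) = mountainPassLevel I r ∧
      ∃ u : ℕ → Xp, IsCeramiSeq (reduced I) c u) ∧
    -- the chain of inequalities and equalities
    0 < sphereInf I r ∧
    sphereInf I r ≤ mountainPassLevel I r ∧
    mountainPassLevel I r ≤
      minimax I {γ ∈ paths I r |
        ∀ t, γ t ∈ lift I '' (Q : Set Xp)} ∧
    minimax I {γ ∈ paths I r |
        ∀ t, γ t ∈ lift I '' (Q : Set Xp)} =
      (⨅ u ∈ nehariSet I ∩ lift I '' (Q : Set Xp),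
        (energy I u : EReal)) ∧
    (⨅ u ∈ nehariSet I ∩ lift I '' (Q : Set Xp),
        (energy I u : EReal)) =
      (⨅ x : Xp, ⨅ _ : x ∈ Q ∧ x ≠ 0, ⨆ t : ℝ, ⨆ _ : 0 ≤ t,
        (energy I (lift I (t • x)) : EReal)) := by
  obtain ⟨hI1, h0, hnonneg⟩ := hI1
  obtain ⟨hr, ha⟩ := hI6
  have hI : IsReducible I := ⟨isReflexiveSpace_snd hX, hI1, hnonneg, hI2, hI3, hI4, hI5⟩
  have hN : NehariInequality I := hI8
  have hneg : ∀ x ∈ Q, x ≠ 0 → ∀ᶠ t : ℝ in atTop, reduced I (t • x) < 0 := fun x hxQ hx =>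
    hI.eventually_reduced_neg (tendsto_of_seq_tendsto fun t ht =>
      hI7 t (fun _ => x) x ht (fun _ => hxQ) tendsto_const_nhds hx)
  have hle₁ := hI.sphereInf_le_mountainPassLevel hr
  have hle₂ : mountainPassLevel I r ≤
      minimax I {γ ∈ paths I r | ∀ t, γ t ∈ lift I '' (Q : Set Xp)} :=
    iInf_le_iInf_of_subset fun γ hγ => hγ.1
  have hpath : ∀ x ∈ Q, x ≠ 0 →
      minimax I {γ ∈ paths I r | ∀ t, γ t ∈ lift I '' (Q : Set Xp)} ≤
        ⨆ t : ℝ, ⨆ _ : 0 ≤ t, (energy I (lift I (t • x)) : EReal) := by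
    intro x hxQ hx
    obtain ⟨R, hR, hmem⟩ := hI.exists_ray_path h0 r hx (hneg x hxQ hx)
    refine (iInf₂_le _ ⟨hmem, fun t => ⟨_, Q.smul_mem _ hxQ, rfl⟩⟩).trans (iSup_le fun t => ?_)
    exact le_iSup₂ (f := fun (t : ℝ) (_ : 0 ≤ t) => (energy I (lift I (t • x)) : EReal))
      ((t : ℝ) * R) (mul_nonneg t.2.1 hR.le)
  have hmeet : (⨅ u ∈ nehariSet I ∩ lift I '' (Q : Set Xp), (energy I u : EReal)) ≤
      minimax I {γ ∈ paths I r | ∀ t, γ t ∈ lift I '' (Q : Set Xp)} := by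
    refine le_iInf₂ fun γ hγ => ?_
    obtain ⟨t, ht⟩ := hN.exists_mem_nehariSet hI h0 hr ha hγ.1
    exact (iInf₂_le (γ t) ⟨ht, hγ.2 t⟩).trans (le_iSup (fun t => (energy I (γ t) : EReal)) t)
  have hray : (⨅ x : Xp, ⨅ _ : x ∈ Q ∧ x ≠ 0, ⨆ t : ℝ, ⨆ _ : 0 ≤ t,
        (energy I (lift I (t • x)) : EReal)) ≤
      ⨅ u ∈ nehariSet I ∩ lift I '' (Q : Set Xp), (energy I u : EReal) := by
    refine le_iInf₂ fun u hu => ?_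
    obtain ⟨hu, x, hxQ, rfl⟩ := hu
    refine (iInf₂_le x ⟨hxQ, by simpa only [hI.lift_fst] using hu.1⟩).trans
      (iSup₂_le fun t ht => ?_)
    exact EReal.coe_le_coe_iff.2 (hN.reduced_le hI hu ht)
  have hmax : (⨅ u ∈ nehariSet I ∩ lift I '' (Q : Set Xp), (energy I u : EReal)) ≤
      ⨅ x : Xp, ⨅ _ : x ∈ Q ∧ x ≠ 0, ⨆ t : ℝ, ⨆ _ : 0 ≤ t,
        (energy I (lift I (t • x)) : EReal) := by
    refine le_iInf₂ fun x hx => ?_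
    obtain ⟨t, ht, hmem⟩ := hI.exists_ray_max h0 hr ha hx.2 (hneg x hx.1 hx.2)
    exact (iInf₂_le _ ⟨hmem, _, Q.smul_mem t hx.1, rfl⟩).trans
      (le_iSup₂ (f := fun (t : ℝ) (_ : 0 ≤ t) => (energy I (lift I (t • x)) : EReal)) t ht.le)
  -- Infinite dimension supplies a nonzero vector of `Q`; its ray carries a path whose energy is
  -- bounded by that of a point of `𝒩`.
  have hfin : mountainPassLevel I r ≠ ⊤ := by
    have hQ0 : Q ≠ ⊥ := by
      rintro rfl
      exact hQ.2 inferInstance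
    obtain ⟨x, hxQ, hx⟩ := Q.ne_bot_iff.1 hQ0
    obtain ⟨t, ht, hmem⟩ := hI.exists_ray_max h0 hr ha hx (hneg x hxQ hx)
    refine ne_top_of_le_ne_top (EReal.coe_ne_top (reduced I (t • x)))
      (hle₂.trans ((hpath (t • x) (Q.smul_mem t hxQ) (smul_ne_zero ht.ne' hx)).trans
        (iSup₂_le fun s hs => ?_)))
    exact EReal.coe_le_coe_iff.2 (hN.reduced_le hI hmem hs)
  have hpos : 0 < mountainPassLevel I r := ha.trans_le hle₁
  have hc : ((mountainPassLevel I r).toReal : EReal) = mountainPassLevel I r :=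
    EReal.coe_toReal hfin (bot_lt_iff_ne_bot.1 (bot_le.trans_lt hpos))
  have hc0 : 0 < (mountainPassLevel I r).toReal := by
    rw [← hc] at hpos
    exact EReal.coe_pos.1 hpos
  exact ⟨hI.existsUnique, hI.contDiff_reduced, ⟨_, hc, hI.exists_ceramiSeq h0 hc0 hc⟩, ha, hle₁,
    hle₂, le_antisymm ((le_iInf₂ fun x hx => hpath x hx.1 hx.2).trans hray) hmeet,
    le_antisymm hmax hray⟩
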